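/- For real $\mu,\nu$ such that neither $\mu+\nu$ nor $\mu-\nu$ is an odd negative integer, and for $z>0$, let $$s_{\mu,\nu}(z)=\frac{z^{\mu+1}}{(\mu-\nu+1)(\mu+\nu+1)}\,{}_1F_2\left(1;\frac{\mu-\nu+3}{2},\frac{\mu+\nu+3}{2};-\frac{z^2}{4}\right)$$ be the Lommel function of the first kind, where ${}_1F_2(a;b,c;x)=\sum_{n\ge 0}\frac{(a)_n}{(b)_n(c)_n}\frac{x^n}{n!}$ and $(a)_n=a(a+1)\cdots(a+n-1)$, $(a)_0=1$. If $z>0$ and $\mu\in\left(-\frac52,-\frac12\right)$ with $\mu\neq-\frac32$, then $$\left[s_{\mu,\frac12}(z)\right]^2-s_{\mu-1,\frac12}(z)\,s_{\mu+1,\frac12}(z)>\frac{1}{\frac12-\mu}\left[s_{\mu,\frac12}(z)\right]^2.$$ -/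

import Mathlib

/-- The generalized hypergeometric function `₁F₂(a; b, c; x) = ∑ (a)ₙ / ((b)ₙ (c)ₙ) xⁿ / n!`
of a real variable, where `(a)ₙ = a (a + 1) ⋯ (a + n - 1)` is the Pochhammer symbol.
It is meant for `b, c ∉ {0, -1, -2, …}`; the series then converges for every `x`. -/
noncomputable def hypergeometric₁F₂ (a b c x : ℝ) : ℝ :=
  ∑' n : ℕ, (ascPochhammer ℝ n).eval a /
    ((ascPochhammer ℝ n).eval b * (ascPochhammer ℝ n).eval c) * (x ^ n / (n.factorial : ℝ))

/-- The Lommel function of the first kind `s_{μ,ν}(z)`, for real `μ`, `ν` such that neither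
`μ + ν` nor `μ - ν` is an odd negative integer, and for `z > 0`. -/
noncomputable def lommelS (μ ν z : ℝ) : ℝ :=
  z ^ (μ + 1) / ((μ - ν + 1) * (μ + ν + 1)) *
    hypergeometric₁F₂ 1 ((μ - ν + 3) / 2) ((μ + ν + 3) / 2) (-(z ^ 2 / 4))

/-! With `b = μ + 3/2` and `f = lommelHalf b`, the functions `s_{μ+1}`, `s_μ`, `s_{μ-1}` are, up to
the factor `z ^ (-1/2)` and constants, `f`, `f'`, `f''`, and `f'' + f = z ^ (b - 1)`. The claim
becomes `f' ^ 2 - f * f'' > 0` (`lommelHalf_laguerre`), whose left side is `E + f * z ^ (b - 1)` for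
the energy `E = f' ^ 2 + f ^ 2 - 2 * f * z ^ (b - 1)`. Where `f < 0` this is immediate. Where `f >
0`, `E` increases because `b < 1`; at the preceding zero of `f` it equals `f' ^ 2 ≥ 0`. Without such
a zero, `b > 0` and `E` is bounded below near `0` by a quantity tending to `0`. Either way `E > 0`.
-/

/-- The function `√z · s_{c - 1/2, 1/2}(z)`, as a series of real powers of `z`. -/
noncomputable def lommelHalf (c z : ℝ) : ℝ :=
  ∑' n : ℕ, (-1) ^ n * z ^ (c + 1 + 2 * n) / (ascPochhammer ℝ (2 * n + 2)).eval c

/-! ### Series: convergence, recurrence, derivative. -/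

theorem ascPochhammer_eval_ne_zero_of_forall {c : ℝ} (hc : ∀ k : ℕ, c + k ≠ 0) (n : ℕ) :
    (ascPochhammer ℝ n).eval c ≠ 0 := by
  induction n with
  | zero => simp
  | succ n ih => rw [ascPochhammer_succ_eval]; exact mul_ne_zero ih (hc n)

theorem ascPochhammer_eval_succ_left (c : ℝ) (n : ℕ) :
    (ascPochhammer ℝ (n + 1)).eval c = c * (ascPochhammer ℝ n).eval (c + 1) := by
  simp [ascPochhammer_succ_left, Polynomial.eval_comp]

theorem ascPochhammer_eval_two_mul_add_two (c : ℝ) (n : ℕ) :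
    (ascPochhammer ℝ (2 * n + 2)).eval c = c * (c + 1) * 4 ^ n *
      ((ascPochhammer ℝ n).eval ((c + 2) / 2) * (ascPochhammer ℝ n).eval ((c + 3) / 2)) := by
  induction n with
  | zero => simp [ascPochhammer_succ_eval]
  | succ n ih =>
    rw [show 2 * (n + 1) + 2 = (2 * n + 2) + 1 + 1 by ring, ascPochhammer_succ_eval,
      ascPochhammer_succ_eval, ih, ascPochhammer_succ_eval, ascPochhammer_succ_eval]
    push_cast
    ring

theorem summable_pow_div_ascPochhammer {c : ℝ} (hc : ∀ k : ℕ, c + k ≠ 0) (R : ℝ) (hR : 0 < R) :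
    Summable fun n : ℕ => R ^ n / |(ascPochhammer ℝ n).eval c| := by
  have hne := ascPochhammer_eval_ne_zero_of_forall hc
  refine summable_of_ratio_test_tendsto_lt_one (l := 0) one_pos
    (Filter.Eventually.of_forall fun n => ?_) ?_
  · exact div_ne_zero (pow_ne_zero _ hR.ne') (abs_ne_zero.2 (hne n))
  · have h1 : Filter.Tendsto (fun n : ℕ => R / |c + n|) Filter.atTop (nhds 0) :=
      Filter.Tendsto.div_atTop tendsto_const_nhds
        (Filter.tendsto_abs_atTop_atTop.comp
          (Filter.tendsto_atTop_add_const_left _ _ tendsto_natCast_atTop_atTop))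
    refine h1.congr fun n => ?_
    have h2 := abs_ne_zero.2 (hne n)
    have h3 := abs_ne_zero.2 (hc n)
    rw [ascPochhammer_succ_eval, abs_mul, Real.norm_of_nonneg (by positivity),
      Real.norm_of_nonneg (by positivity), pow_succ]
    field_simp

theorem norm_lommelHalf_term (c : ℝ) {z : ℝ} (hz : 0 < z) (n : ℕ) :
    ‖(-1) ^ n * z ^ (c + 1 + 2 * n) / (ascPochhammer ℝ (2 * n + 2)).eval c‖ =
      z ^ (c - 1) * (z ^ (2 * n + 2) / |(ascPochhammer ℝ (2 * n + 2)).eval c|) := by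
  have : z ^ (c + 1 + 2 * n) = z ^ (c - 1) * z ^ (2 * n + 2) := by
    rw [← Real.rpow_natCast z (2 * n + 2), ← Real.rpow_add hz]
    congr 1
    push_cast
    ring
  rw [this, norm_div, norm_mul, norm_pow, norm_neg, norm_one, one_pow, one_mul, Real.norm_eq_abs,
    Real.norm_eq_abs, abs_of_pos (by positivity), mul_div_assoc]

theorem summable_lommelHalf_bound {c : ℝ} (hc : ∀ k : ℕ, c + k ≠ 0) {z : ℝ} (hz : 0 < z) :
    Summable fun n : ℕ => z ^ (2 * n + 2) / |(ascPochhammer ℝ (2 * n + 2)).eval c| :=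
  (summable_pow_div_ascPochhammer hc z hz).comp_injective
    (i := fun n : ℕ => 2 * n + 2) fun a b h => by simpa using h

theorem summable_lommelHalf {c : ℝ} (hc : ∀ k : ℕ, c + k ≠ 0) {z : ℝ} (hz : 0 < z) :
    Summable fun n : ℕ =>
      (-1) ^ n * z ^ (c + 1 + 2 * n) / (ascPochhammer ℝ (2 * n + 2)).eval c := by
  refine Summable.of_norm ?_
  simp_rw [norm_lommelHalf_term c hz]
  exact (summable_lommelHalf_bound hc hz).mul_left _

theorem exists_abs_lommelHalf_le {c : ℝ} (hc : ∀ k : ℕ, c + k ≠ 0) :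
    ∃ M : ℝ, 0 ≤ M ∧ ∀ z : ℝ, 0 < z → z ≤ 1 → |lommelHalf c z| ≤ M * z ^ (c + 1) := by
  have hs := summable_lommelHalf_bound hc one_pos
  refine ⟨∑' n : ℕ, (1 : ℝ) ^ (2 * n + 2) / |(ascPochhammer ℝ (2 * n + 2)).eval c|,
    tsum_nonneg fun n => by positivity, fun z hz hz1 => ?_⟩
  rw [← Real.norm_eq_abs, lommelHalf]
  refine tsum_of_norm_bounded (hs.hasSum.mul_right (z ^ (c + 1))) fun n => ?_
  rw [norm_lommelHalf_term c hz, one_pow]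
  have : z ^ (c - 1) * z ^ (2 * n + 2) ≤ z ^ (c + 1) := by
    rw [← Real.rpow_natCast z (2 * n + 2), ← Real.rpow_add hz]
    refine Real.rpow_le_rpow_of_exponent_ge hz hz1 ?_
    push_cast
    linarith [(Nat.cast_nonneg n : (0 : ℝ) ≤ n)]
  rw [← mul_div_assoc, one_div, div_eq_mul_inv, mul_comm]
  gcongr

/-- Splitting off the term `n = 0` shifts `c` by 2. Combined with `hasDerivAt_lommelHalf` used
twice, this is the equation `f'' + f = z ^ (b - 1)`. -/
theorem lommelHalf_recurrence {c : ℝ} (hc : ∀ k : ℕ, c + k ≠ 0) {z : ℝ} (hz : 0 < z) :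
    c * (c + 1) * lommelHalf c z = z ^ (c + 1) - lommelHalf (c + 2) z := by
  have h0 : c ≠ 0 := by simpa using hc 0
  have h1 : c + 1 ≠ 0 := by simpa using hc 1
  have h : lommelHalf c z = _ := (summable_lommelHalf hc hz).tsum_eq_zero_add
  rw [h, mul_add, ← tsum_mul_left, sub_eq_add_neg, lommelHalf, ← tsum_neg]
  congr 1
  · simp [ascPochhammer_succ_eval]
    field_simp
  · refine tsum_congr fun n => ?_
    rw [show 2 * (n + 1) + 2 = (2 * n + 2 + 1) + 1 by ring, ascPochhammer_eval_succ_left,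
      ascPochhammer_eval_succ_left, show c + 1 + 1 = c + 2 by ring,
      show c + 1 + 2 * ((n + 1 : ℕ) : ℝ) = c + 2 + 1 + 2 * n by push_cast; ring]
    have h2 := ascPochhammer_eval_ne_zero_of_forall (c := c + 2)
      (fun k => by have := hc (k + 2); push_cast at this; convert this using 1; ring) (2 * n + 2)
    field_simp
    ring

theorem hasDerivAt_lommelHalf {c : ℝ} (hc : ∀ k : ℕ, c - 1 + k ≠ 0) {z : ℝ} (hz : 0 < z) :
    HasDerivAt (lommelHalf c) ((c - 1) * lommelHalf (c - 1) z) z := by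
  have hc' : ∀ k : ℕ, c + k ≠ 0 := fun k => by
    have := hc (k + 1); push_cast at this; convert this using 1; ring
  -- The sign of `c - 2` is unknown, so the power is bounded by the sum of its values at both
  -- endpoints.
  have hb := ((summable_lommelHalf_bound hc (z := 2 * z) (by positivity)).mul_left
    (((z / 2) ^ (c - 1 - 1) + (2 * z) ^ (c - 1 - 1)))).mul_left |c - 1|
  have hmem : z ∈ Set.Ioo (z / 2) (2 * z) := ⟨by linarith, by linarith⟩
  rw [lommelHalf, ← tsum_mul_left]
  refine hasDerivAt_tsum_of_isPreconnected hb isOpen_Ioo isPreconnected_Ioo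
    (g := fun (n : ℕ) (y : ℝ) =>
      (-1) ^ n * y ^ (c + 1 + 2 * n) / (ascPochhammer ℝ (2 * n + 2)).eval c)
    (g' := fun (n : ℕ) (y : ℝ) => (c - 1) *
      ((-1) ^ n * y ^ (c - 1 + 1 + 2 * n) / (ascPochhammer ℝ (2 * n + 2)).eval (c - 1)))
    (fun n y hy => ?_) (fun n y hy => ?_) hmem (summable_lommelHalf hc' hz) hmem
  · have hy0 : 0 < y := by linarith [hy.1]
    have h := ((Real.hasDerivAt_rpow_const (p := c + 1 + 2 * n) (Or.inl hy0.ne')).const_mul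
      ((-1 : ℝ) ^ n)).div_const ((ascPochhammer ℝ (2 * n + 2)).eval c)
    refine h.congr_deriv ?_
    rw [ascPochhammer_succ_eval (2 * n + 1) c, ascPochhammer_eval_succ_left (c - 1) (2 * n + 1),
      sub_add_cancel, show c + 1 + 2 * (n : ℝ) - 1 = c + 2 * n by ring]
    have h2 := ascPochhammer_eval_ne_zero_of_forall hc' (2 * n + 1)
    have h3 := hc' (2 * n + 1)
    have h4 : c - 1 ≠ 0 := by simpa using hc 0
    push_cast at h3 ⊢
    field_simp
    ring
  · have hy0 : 0 < y := by linarith [hy.1]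
    rw [norm_mul, norm_lommelHalf_term (c - 1) hy0, Real.norm_eq_abs]
    have h1 : y ^ (c - 1 - 1) ≤ (z / 2) ^ (c - 1 - 1) + (2 * z) ^ (c - 1 - 1) := by
      have hp : 0 < (z / 2) ^ (c - 1 - 1) := by positivity
      have hq : 0 < (2 * z) ^ (c - 1 - 1) := by positivity
      rcases le_total 0 (c - 1 - 1) with h | h
      · linarith [Real.rpow_le_rpow hy0.le hy.2.le h]
      · linarith [Real.rpow_le_rpow_of_nonpos (by positivity : 0 < z / 2) hy.1.le h]
    have h2 := hy.2.le
    gcongr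

theorem lommelS_half_eq {μ z : ℝ} (hz : 0 < z) :
    lommelS μ (1 / 2) z = z ^ (-(1 / 2) : ℝ) * lommelHalf (μ + 1 / 2) z := by
  rw [lommelS, hypergeometric₁F₂, lommelHalf, ← tsum_mul_left, ← tsum_mul_left]
  refine tsum_congr fun n => ?_
  rw [ascPochhammer_eval_two_mul_add_two, ascPochhammer_eval_one,
    show (μ + 1 / 2 + 2) / 2 = (μ + 1 / 2 + 3 - 1) / 2 by ring,
    show μ + 1 / 2 + 3 - 1 = μ - 1 / 2 + 3 by ring]
  have h1 : z ^ (μ + 1 / 2 + 1 + 2 * n) = z ^ (1 / 2 : ℝ) * (z ^ (μ + 1) * z ^ (2 * n)) := by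
    rw [← Real.rpow_natCast z (2 * n), ← Real.rpow_add hz, ← Real.rpow_add hz]
    congr 1
    push_cast
    ring
  have h2 : z ^ (-(1 / 2) : ℝ) * z ^ (1 / 2 : ℝ) = 1 := by rw [← Real.rpow_add hz]; simp
  have h3 : (-(z ^ 2 / 4)) ^ n = (-1) ^ n * z ^ (2 * n) * (4 ^ n)⁻¹ := by
    rw [neg_eq_neg_one_mul, mul_pow, div_pow, pow_mul, div_eq_mul_inv, mul_assoc]
  have h4 : (n.factorial : ℝ) ≠ 0 := by positivity
  rw [h1, h3, show μ + 1 / 2 + 1 = μ - 1 / 2 + 1 + 1 by ring]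
  rw [show z ^ (-(1 / 2) : ℝ) * ((-1) ^ n * (z ^ (1 / 2 : ℝ) * (z ^ (μ + 1) * z ^ (2 * n))) /
      ((μ + 1 / 2) * (μ - 1 / 2 + 1 + 1) * 4 ^ n *
        (Polynomial.eval ((μ - 1 / 2 + 3) / 2) (ascPochhammer ℝ n) *
          Polynomial.eval ((μ + 1 / 2 + 3) / 2) (ascPochhammer ℝ n)))) =
      (z ^ (-(1 / 2) : ℝ) * z ^ (1 / 2 : ℝ)) * ((-1) ^ n * (z ^ (μ + 1) * z ^ (2 * n)) /
      ((μ + 1 / 2) * (μ - 1 / 2 + 1 + 1) * 4 ^ n *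
        (Polynomial.eval ((μ - 1 / 2 + 3) / 2) (ascPochhammer ℝ n) *
          Polynomial.eval ((μ + 1 / 2 + 3) / 2) (ascPochhammer ℝ n)))) by ring, h2, one_mul,
    show μ - 1 / 2 + 1 + 1 = μ + 1 / 2 + 1 by ring, show μ - 1 / 2 + 1 = μ + 1 / 2 by ring]
  field_simp

/-! ### Energy monotonicity and zeros. -/

/-- If `f'' + f = z ^ (b - 1)`, the function `f' ^ 2 + f ^ 2 - 2 f z ^ (b - 1)` has derivative
`2 (1 - b) z ^ (b - 2) f`. -/
theorem hasDerivAt_energy {f f' : ℝ → ℝ} {b z : ℝ} (hz : 0 < z) (hf : HasDerivAt f (f' z) z)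
    (hf' : HasDerivAt f' (z ^ (b - 1) - f z) z) :
    HasDerivAt (fun t => f' t ^ 2 + f t ^ 2 - 2 * (f t * t ^ (b - 1)))
      (2 * (1 - b) * z ^ (b - 2) * f z) z := by
  have h := ((hf'.pow 2).add (hf.pow 2)).sub
    ((hf.mul (Real.hasDerivAt_rpow_const (p := b - 1) (Or.inl hz.ne'))).const_mul 2)
  refine h.congr_deriv ?_
  rw [show b - 1 - 1 = b - 2 by ring]
  push_cast
  ring

theorem energy_lt_energy {f f' : ℝ → ℝ} {b s z : ℝ} (hb : b < 1) (hs : 0 < s) (hsz : s < z)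
    (hf : ∀ t, 0 < t → HasDerivAt f (f' t) t)
    (hf' : ∀ t, 0 < t → HasDerivAt f' (t ^ (b - 1) - f t) t)
    (hpos : ∀ t ∈ Set.Ioo s z, 0 < f t) :
    f' s ^ 2 + f s ^ 2 - 2 * (f s * s ^ (b - 1)) <
      f' z ^ 2 + f z ^ 2 - 2 * (f z * z ^ (b - 1)) := by
  have hd : ∀ t : ℝ, 0 < t → _ := fun t ht => hasDerivAt_energy ht (hf t ht) (hf' t ht)
  refine strictMonoOn_of_deriv_pos (convex_Icc s z)
    (fun t ht => (hd t (hs.trans_le ht.1)).continuousAt.continuousWithinAt) (fun t ht => ?_)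
    (Set.left_mem_Icc.2 hsz.le) (Set.right_mem_Icc.2 hsz.le) hsz
  rw [interior_Icc] at ht
  have ht0 := hs.trans ht.1
  rw [(hd t ht0).deriv]
  have := hpos t ht
  have : 0 < 1 - b := by linarith
  positivity

/-- A function with `f z = f' z = 0` and positive second derivative is positive on a left
neighbourhood of `z`. -/
theorem exists_pos_on_left_of_deriv2_pos {f f' : ℝ → ℝ} {z d : ℝ} (hz : 0 < z) (hd : 0 < d)
    (hf : ∀ t, 0 < t → HasDerivAt f (f' t) t) (hf' : HasDerivAt f' d z)
    (h0 : f z = 0) (h1 : f' z = 0) :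
    ∃ s, 0 < s ∧ s < z ∧ ∀ t ∈ Set.Ioo s z, 0 < f t := by
  have hsl := hasDerivAt_iff_tendsto_slope.1 hf'
  have hev : ∀ᶠ t in nhdsWithin z (Set.Iio z), f' t < 0 := by
    have h2 : ∀ᶠ t in nhdsWithin z (Set.Iio z), 0 < slope f' z t :=
      (hsl.mono_left (nhdsWithin_mono _ fun t ht => (ne_of_lt ht : t ≠ z))).eventually
        (lt_mem_nhds hd)
    filter_upwards [h2, self_mem_nhdsWithin] with t ht htz
    rw [slope_def_field, h1, sub_zero] at ht
    by_contra hcon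
    exact absurd ht (not_lt.2 (div_nonpos_of_nonneg_of_nonpos (not_lt.1 hcon)
      (sub_nonpos.2 (le_of_lt htz))))
  obtain ⟨s, hs, hsub⟩ := (mem_nhdsLT_iff_exists_Ioo_subset' (show (0 : ℝ) ∈ Set.Iio z from hz)).1
    hev
  refine ⟨max s (z / 2), by positivity, max_lt hs (by linarith), fun t ht => ?_⟩
  have hst : s < t := (le_max_left _ _).trans_lt ht.1
  have ht0 : 0 < t := lt_of_lt_of_le (by positivity) ((le_max_right s (z / 2)).trans ht.1.le)
  have := strictAntiOn_of_deriv_neg (f := f) (convex_Icc t z)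
    (fun x hx => (hf x (ht0.trans_le hx.1)).continuousAt.continuousWithinAt) (fun x hx => by
      rw [interior_Icc] at hx
      rw [(hf x (ht0.trans hx.1)).deriv]
      exact hsub ⟨hst.trans hx.1, hx.2⟩)
    (Set.left_mem_Icc.2 ht.2.le) (Set.right_mem_Icc.2 ht.2.le) ht.2
  rwa [h0] at this

/-- The last point before `z` where `f ≤ 0`, for `f` positive just before `z`. -/
theorem exists_last_zero_or_pos {f : ℝ → ℝ} {s z : ℝ} (hf : ∀ t, 0 < t → ContinuousAt f t)
    (hsz : s < z) (hpos : ∀ t ∈ Set.Ioo s z, 0 < f t) :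
    (∃ a, 0 < a ∧ a < z ∧ f a = 0 ∧ ∀ t ∈ Set.Ioo a z, 0 < f t) ∨
      ∀ t ∈ Set.Ioo 0 z, 0 < f t := by
  by_cases h : ∀ t ∈ Set.Ioo 0 z, 0 < f t
  · exact Or.inr h
  left
  push Not at h
  obtain ⟨p, ⟨hp0, hpz⟩, hfp⟩ := h
  obtain ⟨m, hsm, hmz⟩ := exists_between hsz
  have hcont : ContinuousOn f (Set.Icc p m) := fun t ht =>
    (hf t (hp0.trans_le ht.1)).continuousWithinAt
  have hfm := hpos m ⟨hsm, hmz⟩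
  have hps : p ≤ s := by
    by_contra hcon
    exact absurd (hpos p ⟨not_le.1 hcon, hpz⟩) (not_lt.2 hfp)
  have hpm : p ≤ m := hps.trans hsm.le
  have hcomp : IsCompact (Set.Icc p m ∩ f ⁻¹' Set.Iic 0) :=
    isCompact_Icc.of_isClosed_subset (hcont.preimage_isClosed_of_isClosed isClosed_Icc isClosed_Iic)
      Set.inter_subset_left
  obtain ⟨a, ⟨⟨hpa, ham⟩, hfa⟩, hmax⟩ := hcomp.exists_isGreatest ⟨p, ⟨le_rfl, hpm⟩, hfp⟩
  have hfa : f a ≤ 0 := hfa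
  have ha0 := hp0.trans_le hpa
  have hafter : ∀ t ∈ Set.Ioo a z, 0 < f t := fun t ht => by
    by_contra hcon
    rcases le_or_gt t m with htm | htm
    · exact absurd (hmax ⟨⟨hpa.trans ht.1.le, htm⟩, not_lt.1 hcon⟩) (not_le.2 ht.1)
    · exact hcon (hpos t ⟨hsm.trans htm, ht.2⟩)
  refine ⟨a, ha0, ham.trans_lt hmz, le_antisymm hfa ?_, hafter⟩
  refine ge_of_tendsto ((hf a ha0).tendsto.mono_left (nhdsWithin_le_nhds (s := Set.Ioi a))) ?_
  filter_upwards [Ioo_mem_nhdsGT (ham.trans_lt hmz)] with t ht using (hafter t ht).le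

/-- The function `lommelHalf b` takes negative values arbitrarily close to `0` if
`-1 < b < 0`. -/
theorem exists_lommelHalf_neg {b z : ℝ} (hb : -1 < b) (hb0 : b < 0) (hz : 0 < z) :
    ∃ t ∈ Set.Ioo 0 z, lommelHalf b t < 0 := by
  have hc : ∀ k : ℕ, b + k ≠ 0 := fun k => by
    rcases k with _ | k
    · simpa using hb0.ne
    · push_cast
      have : (0 : ℝ) ≤ k := k.cast_nonneg
      intro h; linarith
  obtain ⟨M, hM, hbd⟩ := exists_abs_lommelHalf_le (c := b + 2) fun k => by
    have : (0 : ℝ) ≤ k := k.cast_nonneg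
    intro h; linarith
  -- This makes `M * t ^ 2 < 1`, so `t ^ (b + 1)` dominates the tail in the recurrence, while `b *
  -- (b + 1) < 0`.
  obtain ⟨t, ht0, ht⟩ := exists_between (show 0 < min z (1 / (1 + M)) by positivity)
  have htz := ht.trans_le (min_le_left _ _)
  have htM : t * (1 + M) < 1 := (lt_div_iff₀ (by positivity)).1 (ht.trans_le (min_le_right _ _))
  have ht1 : t ≤ 1 := by nlinarith
  refine ⟨t, ⟨ht0, htz⟩, ?_⟩
  have h1 := lommelHalf_recurrence hc ht0
  have h2 := (le_abs_self _).trans (hbd t ht0 ht1)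
  rw [show b + 2 + 1 = (b + 1) + (2 : ℕ) by push_cast; ring, Real.rpow_add_natCast ht0.ne'] at h2
  have h3 : 0 < t ^ (b + 1) := by positivity
  have h4 : M * t ^ 2 < 1 := by nlinarith [mul_nonneg hM ht0.le]
  by_contra hcon
  have h5 : b * (b + 1) * lommelHalf b t ≤ 0 :=
    mul_nonpos_of_nonpos_of_nonneg (by nlinarith) (not_lt.1 hcon)
  nlinarith

/-- `f' ^ 2 - f * f'' > 0` for `f = lommelHalf b`: this function is strictly logarithmically
concave wherever it does not vanish. -/
theorem lommelHalf_laguerre {b z : ℝ} (hb : -1 < b) (hb1 : b < 1) (hb0 : b ≠ 0) (hz : 0 < z) :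
    0 < ((b - 1) * lommelHalf (b - 1) z) ^ 2 -
      lommelHalf b z * (z ^ (b - 1) - lommelHalf b z) := by
  have hc2 : ∀ k : ℕ, b - 1 - 1 + k ≠ 0 := fun k h => by
    rcases k with _ | _ | _ | k
    · norm_num at h; linarith
    · norm_num at h; linarith
    · apply hb0; push_cast at h; linarith
    · push_cast at h; linarith [(k.cast_nonneg : (0 : ℝ) ≤ k)]
  have hc1 : ∀ k : ℕ, b - 1 + k ≠ 0 := fun k => by
    have := hc2 (k + 1); push_cast at this; convert this using 1; ring
  have hc : ∀ k : ℕ, b + k ≠ 0 := fun k => by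
    have := hc1 (k + 1); push_cast at this; convert this using 1; ring
  set f := lommelHalf b with hfdef
  set f' : ℝ → ℝ := fun t => (b - 1) * lommelHalf (b - 1) t with hfdef'
  have hf : ∀ t, 0 < t → HasDerivAt f (f' t) t := fun t ht => hasDerivAt_lommelHalf hc1 ht
  have hf' : ∀ t, 0 < t → HasDerivAt f' (t ^ (b - 1) - f t) t := fun t ht => by
    have h := (hasDerivAt_lommelHalf hc2 ht).const_mul (b - 1)
    have hr := lommelHalf_recurrence hc2 ht
    refine h.congr_deriv ?_
    rw [show b - 1 - 1 + 2 = b by ring, sub_add_cancel] at hr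
    rw [hfdef, ← hr]
    ring
  have key : ∀ s, 0 < s → s < z → 0 ≤ f z → (∀ t ∈ Set.Ioo s z, 0 < f t) →
      0 < f' z ^ 2 + f z ^ 2 - f z * z ^ (b - 1) := by
    intro s hs hsz hfz hpos
    have hzp : 0 ≤ f z * z ^ (b - 1) := by positivity
    rcases exists_last_zero_or_pos (fun t ht => (hf t ht).continuousAt) hsz hpos with
      ⟨a, ha, haz, hfa, hpa⟩ | hp
    · have := energy_lt_energy hb1 ha haz hf hf' hpa
      rw [hfa] at this
      nlinarith [sq_nonneg (f' a)]
    · rcases lt_or_gt_of_ne hb0 with hneg | hbpos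
      · obtain ⟨t, ht, hlt⟩ := exists_lommelHalf_neg hb hneg hz
        exact absurd (hp t ht) (not_lt.2 hlt.le)
      · obtain ⟨M, hM, hbd⟩ := exists_abs_lommelHalf_le hc
        -- The limit at `0` only gives `E (z / 2) ≥ 0`; the step from `z / 2` to `z` restores
        -- strictness.
        have h1 := energy_lt_energy hb1 (half_pos hz) (half_lt_self hz) hf hf'
          fun t ht => hp t ⟨(half_pos hz).trans ht.1, ht.2⟩
        have hlim : Filter.Tendsto (fun t : ℝ => -2 * M * t ^ (2 * b))
            (nhdsWithin 0 (Set.Ioi 0)) (nhds 0) := by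
          have h2 : Filter.Tendsto (fun t : ℝ => t ^ (2 * b)) (nhds 0) (nhds 0) := by
            have := (Real.continuousAt_rpow_const 0 (2 * b) (Or.inr (by positivity))).tendsto
            rwa [Real.zero_rpow (by positivity)] at this
          simpa using (h2.mono_left nhdsWithin_le_nhds).const_mul (-2 * M)
        have h3 := le_of_tendsto hlim (b := f' (z / 2) ^ 2 + f (z / 2) ^ 2 -
          2 * (f (z / 2) * (z / 2) ^ (b - 1))) (by
            filter_upwards [Ioo_mem_nhdsGT (show (0 : ℝ) < min 1 (z / 2) by positivity)] with t ht
            have ht0 : 0 < t := ht.1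
            have h4 := energy_lt_energy hb1 ht0 (ht.2.trans_le (min_le_right _ _)) hf hf'
              fun x hx => hp x ⟨ht0.trans hx.1, hx.2.trans (half_lt_self hz)⟩
            have h5 := (le_abs_self _).trans (hbd t ht0 (ht.2.le.trans (min_le_left _ _)))
            have h6 : f t * t ^ (b - 1) ≤ M * t ^ (2 * b) := by
              rw [show 2 * b = (b + 1) + (b - 1) by ring, Real.rpow_add ht0, ← mul_assoc]
              gcongr
            nlinarith [sq_nonneg (f' t), sq_nonneg (f t)])
        linarith
  suffices h : 0 < f' z ^ 2 + f z ^ 2 - f z * z ^ (b - 1) by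
    have e : f' z ^ 2 + f z ^ 2 - f z * z ^ (b - 1) = f' z ^ 2 - f z * (z ^ (b - 1) - f z) := by
      ring
    rwa [e] at h
  rcases lt_trichotomy (f z) 0 with hneg | hzero | hpos
  · have : 0 < -f z * z ^ (b - 1) := mul_pos (by linarith) (by positivity)
    nlinarith [sq_nonneg (f' z), sq_nonneg (f z)]
  -- At a double zero `f'' = z ^ (b - 1) > 0`, so `f > 0` just to the left and `key` still applies;
  -- such zeros thus cannot occur.
  · by_cases h1 : f' z = 0
    · obtain ⟨s, hs, hsz, hp⟩ := exists_pos_on_left_of_deriv2_pos hz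
        (by rw [hzero, sub_zero]; positivity) hf (hf' z hz) hzero h1
      exact key s hs hsz hzero.ge hp
    · rw [hzero]
      have : 0 < f' z ^ 2 := by positivity
      simpa using this
  · have hev : ∀ᶠ t in nhdsWithin z (Set.Iio z), 0 < f t :=
      ((hf z hz).continuousAt.tendsto.mono_left nhdsWithin_le_nhds).eventually (lt_mem_nhds hpos)
    obtain ⟨s, hs, hsub⟩ :=
      (mem_nhdsLT_iff_exists_Ioo_subset' (show (0 : ℝ) ∈ Set.Iio z from hz)).1 hev
    exact key (max s (z / 2)) (by positivity) (max_lt hs (by linarith)) hpos.le fun t ht =>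
      hsub ⟨(le_max_left _ _).trans_lt ht.1, ht.2⟩

theorem theorem1 (μ z : ℝ) (hz : 0 < z) (hμ : μ ∈ Set.Ioo (-5 / 2 : ℝ) (-1 / 2))
    (hμ' : μ ≠ -3 / 2) :
    lommelS μ (1 / 2) z ^ 2 - lommelS (μ - 1) (1 / 2) z * lommelS (μ + 1) (1 / 2) z >
      1 / (1 / 2 - μ) * lommelS μ (1 / 2) z ^ 2 := by
  obtain ⟨h1, h2⟩ := hμ
  obtain ⟨b, rfl⟩ : ∃ b, μ = b - 3 / 2 := ⟨μ + 3 / 2, by ring⟩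
  have hb0 : b ≠ 0 := fun h => hμ' (by rw [h]; norm_num)
  have hL := lommelHalf_laguerre (b := b) (by linarith) (by linarith) hb0 hz
  have hc : ∀ k : ℕ, b - 2 + k ≠ 0 := fun k h => by
    rcases k with _ | _ | _ | k
    · norm_num at h; linarith
    · norm_num at h; linarith
    · apply hb0; push_cast at h; linarith
    · push_cast at h; linarith [(k.cast_nonneg : (0 : ℝ) ≤ k)]
  have hr := lommelHalf_recurrence hc hz
  rw [sub_add_cancel, show b - 2 + 1 = b - 1 by ring] at hr
  rw [← hr] at hL
  rw [lommelS_half_eq hz, lommelS_half_eq hz, lommelS_half_eq hz,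
    show b - 3 / 2 + 1 / 2 = b - 1 by ring, show b - 3 / 2 - 1 + 1 / 2 = b - 2 by ring,
    show b - 3 / 2 + 1 + 1 / 2 = b by ring, show 1 / 2 - (b - 3 / 2) = 2 - b by ring]
  have hw : 0 < z ^ (-(1 / 2) : ℝ) := by positivity
  set w := z ^ (-(1 / 2) : ℝ)
  set A := lommelHalf (b - 1) z
  set B := lommelHalf (b - 2) z
  set C := lommelHalf b z
  have hp : 0 < (1 - b) * (2 - b) := mul_pos (by linarith) (by linarith)
  have h2b : 2 - b ≠ 0 := by linarith
  have h1b : 1 - b ≠ 0 := by linarith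
  rw [gt_iff_lt, ← sub_pos]
  -- Here `1 - 1 / (2 - b) = (1 - b) / (2 - b)`, which is where the constant in the theorem comes
  -- from.
  have e : (w * A) ^ 2 - w * B * (w * C) - 1 / (2 - b) * (w * A) ^ 2 =
      w ^ 2 * (((b - 1) * A) ^ 2 - C * ((b - 2) * (b - 1) * B)) / ((1 - b) * (2 - b)) := by
    field_simp
    ring
  rw [e]
  positivity
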